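/- Let $\Lambda$ be the ring of symmetric functions over $\mathbb Z$ and $\Lambda_d$ its homogeneous component of degree $d$. The Schur functions $s_\mu$, $\mu\vdash d$, form a $\mathbb Z$-basis of $\Lambda_d$, and $s_{(n)}=h_n$ is the complete homogeneous symmetric function. For partitions $\lambda,\mu$ let $\lambda+\mu$ be their componentwise sum, and for $f=\sum_\mu c_\mu s_\mu\in\Lambda$ put $f+\lambda:=\sum_\mu c_\mu s_{\mu+\lambda}$. Let $\Lambda_{\mathbb N}^{n_0,k}$ be the $\mathbb Z$-module of sequences $\{f_n\}_{n\ge0}$ with $f_n\in\Lambda_{nk+n_0}$ for all $n$. For $m\ge1$ and a partition $\lambda$ with $|\lambda|=mk$, the difference operator $\Delta_m^\lambda$ acts on sequences in $\Lambda_{\mathbb N}^{n_0,k}$ by $\Delta_m^\lambda f_n=f_n-(f_{n-m}+\lambda)$ for $n\ge m$; write $\Delta^\lambda=\Delta^\lambda_1$. An iterated difference $\Delta_{m_1}^{\lambda_1}\cdots\Delta_{m_r}^{\lambda_r}f_n$ is defined for $n\ge m_1+\dots+m_r$. **Proposition.** Let $\alpha_1\ge\alpha_2\ge0$ be integers. (a)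 The sequence $\{s_{(n+\alpha_1)}s_{(n)}\}_n$ lies in $\Lambda_{\mathbb N}^{\alpha_1,2}$ and satisfies $$\Delta^{(2)}\Delta^{(1,1)}\bigl(s_{(n+\alpha_1)}s_{(n)}\bigr)=0\quad\text{for all } n>1.$$ The set $\{\Delta^{(2)},\Delta^{(1,1)}\}$ is minimal in the following sense: if either one of the two operators is removed, the resulting sequence is not eventually zero. (b) The sequence $\{s_{(n+\alpha_1)}s_{(n+\alpha_2)}s_{(n)}\}_n$ lies in $\Lambda_{\mathbb N}^{\alpha_1+\alpha_2,3}$ and satisfies $$\Delta_2^{(3,3)}\Delta^{(3)}\Delta^{(2,1)}\Delta^{(1,1,1)}\bigl(s_{(n+\alpha_1)}s_{(n+\alpha_2)}s_{(n)}\bigr)=0\quad\text{for all } n>\max\{4,\alpha_1-\alpha_2+2\}.$$ The set $\{\Delta_2^{(3,3)},\Delta^{(3)},\Delta^{(2,1)},\Delta^{(1,1,1)}\}$ is minimal in the following sense: if any one of the four operators is removed, the resulting sequence is not eventually zero. -/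

import Mathlib

namespace SymmFun

/-! Symmetric functions over `ℤ` are symmetric formal power series of bounded degree in countably
many variables `x₀, x₁, …`; they live in `MvPowerSeries ℕ ℤ`. -/

/-- `Λ_n`: the symmetric functions with integer coefficients, homogeneous of degree `n`. -/
def Lam (n : ℕ) : Submodule ℤ (MvPowerSeries ℕ ℤ) where
  carrier := {f | (∀ d : ℕ →₀ ℕ, MvPowerSeries.coeff d f ≠ 0 → d.degree = n) ∧
    ∀ (σ : Equiv.Perm ℕ) (d : ℕ →₀ ℕ),
      MvPowerSeries.coeff (d.equivMapDomain σ) f = MvPowerSeries.coeff d f}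
  zero_mem' := by simp
  add_mem' := by
    rintro f g ⟨hf, hf'⟩ ⟨hg, hg'⟩
    refine ⟨fun d hd => ?_, fun σ d => by simp [hf' σ d, hg' σ d]⟩
    by_cases h : MvPowerSeries.coeff d f = 0
    · exact hg d (by simpa [h] using hd)
    · exact hf d h
  smul_mem' := by
    rintro c f ⟨hf, hf'⟩
    have hc : ∀ d, MvPowerSeries.coeff d (c • f) = c * MvPowerSeries.coeff d f := fun d => by
      rw [map_smul, smul_eq_mul]
    refine ⟨fun d hd => hf d fun h => hd ?_, fun σ d => ?_⟩
    · rw [hc, h, mul_zero]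
    · rw [hc, hc, hf' σ d]

/-- `Λ_ℕ^{n₀,k}`: the sequences `(f_n)` with `f_n ∈ Λ_{nk+n₀}` for all `n`. -/
def LamSeq (n₀ k : ℕ) : Submodule ℤ (ℕ → MvPowerSeries ℕ ℤ) where
  carrier := {f | ∀ n, f n ∈ Lam (n * k + n₀)}
  zero_mem' := fun _ => Submodule.zero_mem _
  add_mem' := fun hf hg n => Submodule.add_mem _ (hf n) (hg n)
  smul_mem' := fun c _ hf n => Submodule.smul_mem _ c (hf n)

/-- The weight (content) of a semistandard Young tableau: the exponent of `x_i` is the number of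
entries equal to `i`. -/
noncomputable def weight {μ : YoungDiagram} (T : SemistandardYoungTableau μ) : ℕ →₀ ℕ :=
  ∑ c ∈ μ.cells, Finsupp.single (T c.1 c.2) 1

/-- The Schur function `s_μ = ∑_T x^{weight T}`, the sum over all semistandard Young tableaux of
shape `μ`. -/
noncomputable def schur (μ : YoungDiagram) : MvPowerSeries ℕ ℤ :=
  fun d => (Nat.card {T : SemistandardYoungTableau μ // weight T = d} : ℤ)

theorem weight_apply {μ : YoungDiagram} (T : SemistandardYoungTableau μ) (i : ℕ) :
    weight T i = (μ.cells.filter fun c => T c.1 c.2 = i).card := by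
  classical
  simp [weight, Finsupp.finsetSum_apply, Finsupp.single_apply]

/-- There are finitely many tableaux of given shape and weight. -/
instance finite_weight (μ : YoungDiagram) (d : ℕ →₀ ℕ) :
    Finite {T : SemistandardYoungTableau μ // weight T = d} := by
  classical
  have key : ∀ (T : {T : SemistandardYoungTableau μ // weight T = d}) (c : μ.cells),
      T.1 c.1.1 c.1.2 ∈ d.support := by
    rintro ⟨T, rfl⟩ c
    rw [Finsupp.mem_support_iff, weight_apply, Finset.card_ne_zero]
    exact ⟨c.1, by simp [-YoungDiagram.mem_cells, c.2]⟩
  refine Finite.of_injective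
    (fun (T : {T : SemistandardYoungTableau μ // weight T = d}) (c : μ.cells) =>
      (⟨T.1 c.1.1 c.1.2, key T c⟩ : d.support)) ?_
  intro T T' h
  apply Subtype.ext
  ext i j
  by_cases hc : (i, j) ∈ μ
  · exact congrArg Subtype.val (congrFun h ⟨(i, j), by simpa using hc⟩)
  · rw [T.1.zeros hc, T'.1.zeros hc]

theorem le_entry {μ : YoungDiagram} (T : SemistandardYoungTableau μ) {i j : ℕ}
    (h : (i, j) ∈ μ) : i ≤ T i j := by
  induction i with
  | zero => exact Nat.zero_le _
  | succ i ih =>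
    exact (ih (μ.up_left_mem (Nat.le_succ i) le_rfl h)).trans_lt (T.col_strict (Nat.lt_succ_self i) h)

/-- The partial sums `μ₁ + ⋯ + μ_k` of the parts of a partition. -/
def partialSum (μ : YoungDiagram) (k : ℕ) : ℕ := ∑ i ∈ Finset.range k, μ.rowLen i

theorem eq_of_rowLen_eq {μ ν : YoungDiagram} (h : ∀ i, μ.rowLen i = ν.rowLen i) : μ = ν := by
  ext ⟨i, j⟩
  rw [YoungDiagram.mem_cells, YoungDiagram.mem_cells, YoungDiagram.mem_iff_lt_rowLen,
    YoungDiagram.mem_iff_lt_rowLen, h]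

theorem partialSum_injective : Function.Injective partialSum := by
  intro μ ν h
  refine eq_of_rowLen_eq fun i => ?_
  have h1 := congrFun h (i + 1)
  have h0 := congrFun h i
  simp only [partialSum, Finset.sum_range_succ] at h0 h1
  omega

theorem partialSum_eq_card (μ : YoungDiagram) (k : ℕ) :
    partialSum μ k = (μ.cells.filter fun c => c.1 < k).card := by
  classical
  rw [partialSum, Finset.card_eq_sum_card_fiberwise (f := Prod.fst) (t := Finset.range k)]
  · refine Finset.sum_congr rfl fun i hi => ?_
    rw [YoungDiagram.rowLen_eq_card, YoungDiagram.row, Finset.filter_filter]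
    congr 1
    ext c
    simp only [Finset.mem_filter, Finset.mem_range] at hi ⊢
    constructor
    · rintro ⟨h, rfl⟩; exact ⟨h, hi, rfl⟩
    · rintro ⟨h, _, h'⟩; exact ⟨h, h'⟩
  · intro c hc
    simpa using (Finset.mem_filter.1 hc).2

/-- If a tableau of shape `μ` has weight `ν`, then `μ` dominates `ν`. -/
theorem partialSum_le {μ ν : YoungDiagram} (T : SemistandardYoungTableau μ)
    (h : ∀ i, weight T i = ν.rowLen i) : partialSum ν ≤ partialSum μ := by
  classical
  intro k
  have : partialSum ν k = (μ.cells.filter fun c => T c.1 c.2 < k).card := by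
    rw [partialSum, Finset.card_eq_sum_card_fiberwise (f := fun c => T c.1 c.2)
      (t := Finset.range k)]
    · refine Finset.sum_congr rfl fun i hi => ?_
      rw [← h, weight_apply, Finset.filter_filter]
      congr 1
      ext c
      simp only [Finset.mem_filter, Finset.mem_range] at hi ⊢
      constructor
      · rintro ⟨h, rfl⟩; exact ⟨h, hi, rfl⟩
      · rintro ⟨h, _, h'⟩; exact ⟨h, h'⟩
    · intro c hc
      simpa using (Finset.mem_filter.1 hc).2
  rw [this, partialSum_eq_card]
  refine Finset.card_le_card fun c hc => ?_
  simp only [Finset.mem_filter, YoungDiagram.mem_cells] at hc ⊢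
  exact ⟨hc.1, (le_entry T hc.1).trans_lt hc.2⟩

theorem weight_highestWeight (μ : YoungDiagram) (i : ℕ) :
    weight (SemistandardYoungTableau.highestWeight μ) i = μ.rowLen i := by
  classical
  rw [weight_apply, YoungDiagram.rowLen_eq_card, YoungDiagram.row]
  congr 1
  refine Finset.filter_congr fun c hc => ?_
  have : (c.1, c.2) ∈ μ := by simpa using hc
  simp [this]

/-- The Schur functions are linearly independent over `ℤ`. -/
theorem schur_linearIndependent : LinearIndependent ℤ schur := by
  classical
  rw [linearIndependent_iff]
  intro l hl
  by_contra hne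
  have hs : l.support.Nonempty := Finsupp.support_nonempty_iff.2 hne
  obtain ⟨ν, hν, hmax⟩ := l.support.exists_maximalFor partialSum hs
  set d := weight (SemistandardYoungTableau.highestWeight ν) with hd
  have h0 := congrArg (MvPowerSeries.coeff d) hl
  rw [Finsupp.linearCombination_apply, Finsupp.sum, map_sum,
    Finset.sum_eq_single_of_mem ν hν] at h0
  · have hc : MvPowerSeries.coeff d (schur ν) ≠ 0 := by
      have : Nonempty {T : SemistandardYoungTableau ν // weight T = d} := ⟨⟨_, hd.symm⟩⟩
      exact Nat.cast_ne_zero.2 (Nat.card_pos (α := {T : SemistandardYoungTableau ν // weight T = d})).ne'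
    rw [map_smul, map_zero, smul_eq_mul, mul_eq_zero] at h0
    exact h0.elim (Finsupp.mem_support_iff.1 hν) hc
  · intro μ hμ hμν
    rw [map_smul, smul_eq_mul]
    refine mul_eq_zero_of_right _ ?_
    change ((Nat.card {T : SemistandardYoungTableau μ // weight T = d} : ℕ) : ℤ) = 0
    have : IsEmpty {T : SemistandardYoungTableau μ // weight T = d} := by
      refine ⟨fun ⟨T, hT⟩ => hμν ?_⟩
      have hle : partialSum ν ≤ partialSum μ :=
        partialSum_le T fun i => by rw [hT, hd, weight_highestWeight]
      exact partialSum_injective (le_antisymm (hmax hμ hle) hle)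
    simp

/-- The componentwise sum `μ + ν` of two partitions, see `rowLen_addParts`. -/
def addParts (μ ν : YoungDiagram) : YoungDiagram where
  cells := (Finset.range (μ.colLen 0 + ν.colLen 0) ×ˢ
    Finset.range (μ.rowLen 0 + ν.rowLen 0)).filter fun c => c.2 < μ.rowLen c.1 + ν.rowLen c.1
  isLowerSet := by
    rintro ⟨i, j⟩ ⟨i', j'⟩ ⟨hi, hj⟩ h
    simp only [Finset.coe_filter, Finset.mem_product, Finset.mem_range, Set.mem_ofPred_eq] at *
    have h1 := μ.rowLen_anti i' i hi
    have h2 := ν.rowLen_anti i' i hi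
    omega

theorem rowLen_addParts (μ ν : YoungDiagram) (i : ℕ) :
    (addParts μ ν).rowLen i = μ.rowLen i + ν.rowLen i := by
  have key : ∀ j, j < (addParts μ ν).rowLen i ↔ j < μ.rowLen i + ν.rowLen i := by
    intro j
    rw [← YoungDiagram.mem_iff_lt_rowLen, ← YoungDiagram.mem_cells]
    simp only [addParts, Finset.mem_filter, Finset.mem_product, Finset.mem_range]
    refine ⟨fun h => h.2, fun h => ⟨⟨?_, ?_⟩, h⟩⟩
    · by_cases hμ : 0 < μ.rowLen i
      · have := YoungDiagram.mem_iff_lt_colLen.1 (YoungDiagram.mem_iff_lt_rowLen.2 hμ)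
        omega
      · have hν : 0 < ν.rowLen i := by omega
        have := YoungDiagram.mem_iff_lt_colLen.1 (YoungDiagram.mem_iff_lt_rowLen.2 hν)
        omega
    · have h1 := μ.rowLen_anti 0 i (Nat.zero_le _)
      have h2 := ν.rowLen_anti 0 i (Nat.zero_le _)
      omega
  exact le_antisymm (le_of_forall_lt fun j hj => (key j).1 hj)
    (le_of_forall_lt fun j hj => (key j).2 hj)

open Classical in
/-- `f + ν` for a symmetric function `f`: the linear extension of `s_μ + ν := s_{μ+ν}`, that is,
`∑ c_μ s_μ ↦ ∑ c_μ s_{μ+ν}`. Every symmetric function is a unique integral combination of Schur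
functions; series outside their span, which are not symmetric functions, are sent to `0`. -/
noncomputable def shift (ν : YoungDiagram) (f : MvPowerSeries ℕ ℤ) : MvPowerSeries ℕ ℤ :=
  if hf : f ∈ Submodule.span ℤ (Set.range schur) then
    Finsupp.linearCombination ℤ (fun μ => schur (addParts μ ν))
      (schur_linearIndependent.repr ⟨f, hf⟩)
  else 0

theorem shift_linearCombination (ν : YoungDiagram) (c : YoungDiagram →₀ ℤ) :
    shift ν (Finsupp.linearCombination ℤ schur c) =
      Finsupp.linearCombination ℤ (fun μ => schur (addParts μ ν)) c := by
  have hf : Finsupp.linearCombination ℤ schur c ∈ Submodule.span ℤ (Set.range schur) := by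
    rw [← Finsupp.range_linearCombination]
    exact ⟨c, rfl⟩
  rw [shift, dif_pos hf, schur_linearIndependent.repr_eq rfl]

/-- The difference operator `Δ_m^ν`: `(Δ_m^ν f)_n = f_n - (f_{n-m} + ν)` for `n ≥ m`.
For `n < m`, where it is not defined, the term `f_{n-m}` is read as `0`. -/
noncomputable def Diff (m : ℕ) (ν : YoungDiagram) (f : ℕ → MvPowerSeries ℕ ℤ) :
    ℕ → MvPowerSeries ℕ ℤ :=
  fun n => if m ≤ n then f n - shift ν (f (n - m)) else f n

/-- The partition with the given weakly decreasing list of parts (zeros in the list are ignored). -/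
abbrev part (w : List ℕ) (hw : w.SortedGE := by decide) : YoungDiagram :=
  YoungDiagram.ofRowLens w hw

/-- The one-row Schur function `s_{(n)}` (which is the complete homogeneous `h_n`). -/
noncomputable def schurRow (n : ℕ) : MvPowerSeries ℕ ℤ :=
  schur (part [n] (fun i j _ => by simp))

/-- A sequence is eventually zero. -/
def EventuallyZero (f : ℕ → MvPowerSeries ℕ ℤ) : Prop :=
  ∃ N, ∀ n > N, f n = 0

end SymmFun

namespace SymmFun

open MvPowerSeries

/-! A product of at most three complete homogeneous functions expands into Schur functions with at
most three rows, and its coefficients are Kostka numbers: lengths of explicit integer intervals.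
Adding `ν` translates the coefficient function, and by linear independence a term of a sequence
vanishes exactly when all its coefficients do. The proposition thus becomes a family of piecewise
linear identities over ℤ, left to `omega`.

For three factors, Δ^{(1,1,1)} removes all shapes with a third row; Δ^{(2,1)} then leaves every
two-row shape with coefficient 1; Δ^{(3)} leaves those whose rows differ by at most 2; Δ_2^{(3,3)}
kills these, since adding (3,3) preserves the difference of the rows. For minimality, one shape with
nonzero coefficient is exhibited for all large `n`.

The expansion is Pieri's rule (`schur_pieri`), proved in finitely many variables by induction from
the branching rule (`card_weight_rows`). The closed formula is `hasSchurCoeffs_kostka`. -/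

/-! ### Removing the largest letter from a tableau. -/

theorem entry_mem_support_weight {μ : YoungDiagram} (T : SemistandardYoungTableau μ) {i j : ℕ}
    (h : (i, j) ∈ μ) : weight T (T i j) ≠ 0 := by
  rw [weight_apply, Finset.card_ne_zero]
  exact ⟨(i, j), by simpa using h⟩

theorem weight_eq_zero {μ : YoungDiagram} (T : SemistandardYoungTableau μ) {k : ℕ}
    (h : ∀ i j, (i, j) ∈ μ → T i j ≠ k) : weight T k = 0 := by
  rw [weight_apply, Finset.card_eq_zero, Finset.filter_eq_empty_iff]
  rintro ⟨i, j⟩ hc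
  exact h i j (by simpa using hc)

theorem degree_weight {μ : YoungDiagram} (T : SemistandardYoungTableau μ) :
    (weight T).degree = μ.card := by
  simp [weight, YoungDiagram.card]

/-- The weight of a tableau all of whose entries outside a subdiagram equal `N`. -/
theorem weight_extend {μ ν : YoungDiagram} (hνμ : ν ≤ μ) {N : ℕ}
    (T : SemistandardYoungTableau μ) (T' : SemistandardYoungTableau ν)
    (h1 : ∀ i j, (i, j) ∈ ν → T i j = T' i j)
    (h2 : ∀ i j, (i, j) ∈ μ → (i, j) ∉ ν → T i j = N) :
    weight T = weight T' + Finsupp.single N (μ.card - ν.card) := by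
  have hs : ν.cells ⊆ μ.cells := hνμ
  rw [weight, ← Finset.sum_sdiff hs, add_comm]
  congr 1
  · refine Finset.sum_congr rfl fun c hc => ?_
    rw [h1 c.1 c.2 (by simpa using hc)]
  · rw [Finset.sum_congr rfl (g := fun _ => Finsupp.single N 1)]
    · simp [YoungDiagram.card, Finset.card_sdiff_of_subset hs]
    · intro c hc
      rw [Finset.mem_sdiff] at hc
      rw [h2 c.1 c.2 (by simpa using hc.1) (by simpa using hc.2)]

/-- The restriction of a tableau to a subdiagram. -/
noncomputable def restrict {μ ν : YoungDiagram} (hνμ : ν ≤ μ) (T : SemistandardYoungTableau μ) :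
    SemistandardYoungTableau ν := by
  classical exact
  { entry := fun i j => if (i, j) ∈ ν then T i j else 0
    row_weak' := fun {i j₁ j₂} hj h => by
      rw [if_pos h, if_pos (ν.up_left_mem le_rfl hj.le h)]
      exact T.row_weak hj (hνμ h)
    col_strict' := fun {i₁ i₂ j} hi h => by
      rw [if_pos h, if_pos (ν.up_left_mem hi.le le_rfl h)]
      exact T.col_strict hi (hνμ h)
    zeros' := fun {i j} h => if_neg h }

theorem restrict_of_mem {μ ν : YoungDiagram} (hνμ : ν ≤ μ) (T : SemistandardYoungTableau μ)
    {i j : ℕ} (h : (i, j) ∈ ν) : restrict hνμ T i j = T i j :=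
  if_pos h

/-- The extension of a tableau with entries less than `N` by a horizontal strip filled with `N`. -/
noncomputable def extend {μ ν : YoungDiagram} (hνμ : ν ≤ μ)
    (hstrip : ∀ i j, (i + 1, j) ∈ μ → (i, j) ∈ ν) {N : ℕ} (T : SemistandardYoungTableau ν)
    (hlt : ∀ i j, (i, j) ∈ ν → T i j < N) : SemistandardYoungTableau μ := by
  classical exact
  { entry := fun i j => if (i, j) ∈ ν then T i j else if (i, j) ∈ μ then N else 0
    row_weak' := fun {i j₁ j₂} hj h => by
      have h' := μ.up_left_mem le_rfl hj.le h
      by_cases h2 : (i, j₂) ∈ ν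
      · rw [if_pos h2, if_pos (ν.up_left_mem le_rfl hj.le h2)]
        exact T.row_weak hj h2
      · rw [if_neg h2, if_pos h]
        split_ifs with h1
        · exact (hlt _ _ h1).le
        · exact le_rfl
    col_strict' := fun {i₁ i₂ j} hi h => by
      -- The strip condition puts every cell above row `i₂` of this column into `ν`, so no column
      -- contains `N` twice.
      obtain ⟨i, rfl⟩ : ∃ i, i₂ = i + 1 := ⟨i₂ - 1, by omega⟩
      have h1 : (i₁, j) ∈ ν := ν.up_left_mem (by omega) le_rfl (hstrip i j h)
      rw [if_pos h1]
      split_ifs with h2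
      · exact T.col_strict hi h2
      · exact hlt _ _ h1
    zeros' := fun {i j} h => by rw [if_neg fun h' => h (hνμ h'), if_neg h] }

section extend

variable {μ ν : YoungDiagram} (hνμ : ν ≤ μ) (hstrip : ∀ i j, (i + 1, j) ∈ μ → (i, j) ∈ ν)
  {N : ℕ} (T : SemistandardYoungTableau ν) (hlt : ∀ i j, (i, j) ∈ ν → T i j < N) {i j : ℕ}

theorem extend_of_mem (h : (i, j) ∈ ν) : extend hνμ hstrip T hlt i j = T i j :=
  if_pos h

theorem extend_of_notMem (h : (i, j) ∈ μ) (h' : (i, j) ∉ ν) : extend hνμ hstrip T hlt i j = N :=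
  (if_neg h').trans (if_pos h)

end extend

/-- The tableaux of shape `μ` whose entries below `N` fill the shape `ν` correspond to the
tableaux of shape `ν`. -/
theorem card_fiber {μ ν : YoungDiagram} {N : ℕ} {d : ℕ →₀ ℕ} (hνμ : ν ≤ μ)
    (hstrip : ∀ i j, (i + 1, j) ∈ μ → (i, j) ∈ ν) (hd : ∀ i, N < i → d i = 0)
    (hN : μ.card - ν.card = d N) :
    Nat.card {T : SemistandardYoungTableau μ // weight T = d ∧
      ∀ i j, (i, j) ∈ ν ↔ (i, j) ∈ μ ∧ T i j < N} =
    Nat.card {T : SemistandardYoungTableau ν // weight T = d.erase N} := by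
  have hlt : ∀ T : SemistandardYoungTableau ν, weight T = d.erase N → ∀ i j,
      (i, j) ∈ ν → T i j < N := by
    intro T hT i j h
    have h0 := entry_mem_support_weight T h
    rw [hT, Finsupp.erase_apply] at h0
    by_contra hge
    rcases eq_or_lt_of_le (not_lt.1 hge) with he | hl
    · rw [if_pos he.symm] at h0; exact h0 rfl
    · rw [if_neg hl.ne'] at h0; exact h0 (hd _ hl)
  have heq : ∀ T : SemistandardYoungTableau μ, weight T = d →
      (∀ i j, (i, j) ∈ ν ↔ (i, j) ∈ μ ∧ T i j < N) →
      ∀ i j, (i, j) ∈ μ → (i, j) ∉ ν → T i j = N := by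
    intro T hT hTν i j h h'
    refine le_antisymm ?_ (not_lt.1 fun hl => h' ((hTν i j).2 ⟨h, hl⟩))
    by_contra hc
    exact entry_mem_support_weight T h (by rw [hT]; exact hd _ (not_le.1 hc))
  refine Nat.card_congr
    { toFun := fun T => ⟨restrict hνμ T.1, ?_⟩
      invFun := fun T => ⟨extend hνμ hstrip T.1 (hlt T.1 T.2), ?_, ?_⟩
      left_inv := ?_
      right_inv := ?_ }
  · obtain ⟨T, hT, hTν⟩ := T
    have hw := weight_extend (N := N) hνμ T (restrict hνμ T)
      (fun i j h => (restrict_of_mem hνμ T h).symm) (heq T hT hTν)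
    ext k
    rw [Finsupp.erase_apply]
    split_ifs with hk
    · subst hk
      refine weight_eq_zero _ fun i j h => ?_
      rw [restrict_of_mem hνμ T h]
      exact ((hTν i j).1 h).2.ne
    · have := DFunLike.congr_fun hw k
      rw [Finsupp.add_apply, Finsupp.single_apply, if_neg (Ne.symm hk), add_zero, hT] at this
      exact this.symm
  · rw [weight_extend (N := N) hνμ _ T.1 (fun i j h => extend_of_mem hνμ hstrip _ _ h)
      (fun i j h h' => extend_of_notMem hνμ hstrip _ _ h h'), T.2, hN]
    ext k
    by_cases hk : k = N
    · subst hk; simp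
    · simp [hk]
  · intro i j
    constructor
    · intro h
      rw [extend_of_mem hνμ hstrip _ _ h]
      exact ⟨hνμ h, hlt T.1 T.2 i j h⟩
    · rintro ⟨h, h'⟩
      by_contra hn
      rw [extend_of_notMem hνμ hstrip _ _ h hn] at h'
      exact lt_irrefl _ h'
  · rintro ⟨T, hT, hTν⟩
    apply Subtype.ext
    ext i j
    have hlt' : ∀ i j, (i, j) ∈ ν → restrict hνμ T i j < N := fun i j h => by
      rw [restrict_of_mem hνμ T h]
      exact ((hTν i j).1 h).2
    change extend hνμ hstrip (restrict hνμ T) hlt' i j = T i j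
    by_cases h1 : (i, j) ∈ ν
    · rw [extend_of_mem hνμ hstrip _ _ h1, restrict_of_mem hνμ T h1]
    · by_cases h2 : (i, j) ∈ μ
      · rw [extend_of_notMem hνμ hstrip _ _ h2 h1, heq T hT hTν i j h2 h1]
      · rw [T.zeros h2, SemistandardYoungTableau.zeros _ h2]
  · rintro ⟨T, hT⟩
    apply Subtype.ext
    ext i j
    by_cases h1 : (i, j) ∈ ν
    · exact (restrict_of_mem hνμ _ h1).trans (extend_of_mem hνμ hstrip T (hlt T hT) h1)
    · rw [T.zeros h1, SemistandardYoungTableau.zeros _ h1]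

/-! ### The branching rule for shapes with at most three rows. -/

/-- The diagram with at most three rows, of lengths `a ≥ b ≥ c`. -/
def rows (t : ℕ × ℕ × ℕ) : YoungDiagram :=
  -- The minima make `rows` total; on partitions they change nothing.
  YoungDiagram.ofRowLens [t.1, min t.1 t.2.1, min (min t.1 t.2.1) t.2.2] (by
    simp [List.sortedGE_iff_pairwise])

/-- The triple consists of the parts of a partition. -/
def IsPartition (t : ℕ × ℕ × ℕ) : Prop := t.2.1 ≤ t.1 ∧ t.2.2 ≤ t.2.1

/-- The sum of the parts. -/
def size (t : ℕ × ℕ × ℕ) : ℕ := t.1 + t.2.1 + t.2.2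

theorem mem_rows {t : ℕ × ℕ × ℕ} (ht : IsPartition t) {i j : ℕ} :
    (i, j) ∈ rows t ↔ (i = 0 ∧ j < t.1) ∨ (i = 1 ∧ j < t.2.1) ∨ (i = 2 ∧ j < t.2.2) := by
  obtain ⟨a, b, c⟩ := t
  simp only [IsPartition] at ht
  rw [rows, YoungDiagram.mem_ofRowLens]
  rcases i with _ | _ | _ | i <;> simp <;> omega

theorem rowLen_rows {t : ℕ × ℕ × ℕ} (ht : IsPartition t) (i : ℕ) :
    (rows t).rowLen i = if i = 0 then t.1 else if i = 1 then t.2.1 else if i = 2 then t.2.2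
      else 0 := by
  refine eq_of_forall_lt_iff fun j => ?_
  rw [← YoungDiagram.mem_iff_lt_rowLen, mem_rows ht]
  split_ifs <;> omega

theorem card_rows {t : ℕ × ℕ × ℕ} (ht : IsPartition t) : (rows t).card = size t := by
  have h := partialSum_eq_card (rows t) 3
  rw [Finset.filter_true_of_mem] at h
  · rw [YoungDiagram.card, ← h, partialSum]
    simp [Finset.sum_range_succ, rowLen_rows ht, size]
  · rintro ⟨i, j⟩ hc
    rw [YoungDiagram.mem_cells, mem_rows ht] at hc
    change i < 3
    omega

theorem rows_injOn : Set.InjOn rows {t | IsPartition t} := by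
  rintro ⟨a, b, c⟩ ht ⟨a', b', c'⟩ ht' h
  have h0 := congrArg (fun μ => μ.rowLen 0) h
  have h1 := congrArg (fun μ => μ.rowLen 1) h
  have h2 := congrArg (fun μ => μ.rowLen 2) h
  simp only [rowLen_rows ht, rowLen_rows ht'] at h0 h1 h2
  simp_all

/-- The triples interlacing with `t`. -/
def below (t : ℕ × ℕ × ℕ) : Finset (ℕ × ℕ × ℕ) :=
  Finset.Icc t.2.1 t.1 ×ˢ Finset.Icc t.2.2 t.2.1 ×ˢ Finset.Icc 0 t.2.2

theorem mem_below {t u : ℕ × ℕ × ℕ} : u ∈ below t ↔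
    (t.2.1 ≤ u.1 ∧ u.1 ≤ t.1) ∧ (t.2.2 ≤ u.2.1 ∧ u.2.1 ≤ t.2.1) ∧ u.2.2 ≤ t.2.2 := by
  simp [below]

theorem isPartition_of_mem_below {t u : ℕ × ℕ × ℕ} (h : u ∈ below t) : IsPartition u := by
  rw [mem_below] at h
  simp only [IsPartition]
  omega

/-- The entries below the largest letter `N` form a subdiagram. A cell with another cell beneath it
has an entry less than `N`, so each row of the subdiagram is at least as long as the next row of
`t`; this is interlacing. -/
theorem exists_mem_below {t : ℕ × ℕ × ℕ} (ht : IsPartition t)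
    (T : SemistandardYoungTableau (rows t)) {N : ℕ} (hT : ∀ i j, (i, j) ∈ rows t → T i j ≤ N) :
    ∃ u ∈ below t, ∀ i j, (i, j) ∈ rows u ↔ (i, j) ∈ rows t ∧ T i j < N := by
  classical
  let ν : YoungDiagram :=
    { cells := (rows t).cells.filter fun c => T c.1 c.2 < N
      isLowerSet := by
        rintro ⟨i, j⟩ ⟨i', j'⟩ ⟨hi, hj⟩ h
        simp only [Finset.coe_filter, Set.mem_ofPred_eq, YoungDiagram.mem_cells] at h ⊢
        have h1 := (rows t).up_left_mem hi le_rfl h.1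
        exact ⟨(rows t).up_left_mem hi hj h.1,
          ((T.row_weak_of_le hj h1).trans (T.col_weak hi h.1)).trans_lt h.2⟩ }
  have hν : ∀ i j, j < ν.rowLen i ↔ (i, j) ∈ rows t ∧ T i j < N := fun i j => by
    rw [← YoungDiagram.mem_iff_lt_rowLen, ← YoungDiagram.mem_cells]
    simp [ν]
  have hup : ∀ i j, (i + 1, j) ∈ rows t → j < ν.rowLen i := fun i j h => by
    rw [hν]
    exact ⟨(rows t).up_left_mem (Nat.le_succ i) le_rfl h,
      (T.col_strict (Nat.lt_succ_self i) h).trans_le (hT _ _ h)⟩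
  have hle : ∀ i, ν.rowLen i ≤ (rows t).rowLen i := fun i => le_of_forall_lt fun j hj =>
    YoungDiagram.mem_iff_lt_rowLen.1 ((hν i j).1 hj).1
  have hge : ∀ i, (rows t).rowLen (i + 1) ≤ ν.rowLen i := fun i => le_of_forall_lt fun j hj =>
    hup i j (YoungDiagram.mem_iff_lt_rowLen.2 hj)
  have l0 := hle 0
  have l1 := hle 1
  have l2 := hle 2
  have g0 := hge 0
  have g1 := hge 1
  simp only [rowLen_rows ht] at l0 l1 l2 g0 g1
  norm_num at l0 l1 l2 g0 g1
  have hu : (ν.rowLen 0, ν.rowLen 1, ν.rowLen 2) ∈ below t := mem_below.2 (by simp only; omega)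
  refine ⟨_, hu, fun i j => ?_⟩
  rw [mem_rows (isPartition_of_mem_below hu), ← hν]
  constructor
  · rintro (⟨rfl, h⟩ | ⟨rfl, h⟩ | ⟨rfl, h⟩) <;> exact h
  · intro h
    have h' := ((hν i j).1 h).1
    rw [mem_rows ht] at h'
    rcases h' with ⟨rfl, _⟩ | ⟨rfl, _⟩ | ⟨rfl, _⟩ <;> simp [h]

/-- The branching rule. -/
theorem card_weight_rows {t : ℕ × ℕ × ℕ} (ht : IsPartition t) {N : ℕ} {d : ℕ →₀ ℕ}
    (hd : ∀ i, N < i → d i = 0) :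
    Nat.card {T : SemistandardYoungTableau (rows t) // weight T = d} =
      ∑ u ∈ below t, if size t - size u = d N then
        Nat.card {T : SemistandardYoungTableau (rows u) // weight T = d.erase N} else 0 := by
  classical
  have hle : ∀ T : SemistandardYoungTableau (rows t), weight T = d →
      ∀ i j, (i, j) ∈ rows t → T i j ≤ N := fun T hT i j h => by
    by_contra hc
    exact entry_mem_support_weight T h (by rw [hT]; exact hd _ (not_le.1 hc))
  choose f hf hf' using fun T : {T : SemistandardYoungTableau (rows t) // weight T = d} =>
    exists_mem_below ht T.1 (hle T.1 T.2)
  have hfeq : ∀ T u, u ∈ below t → (f T = u ↔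
      ∀ i j, (i, j) ∈ rows u ↔ (i, j) ∈ rows t ∧ T.1 i j < N) := by
    intro T u hu
    refine ⟨fun h => h ▸ hf' T, fun h => rows_injOn (isPartition_of_mem_below (hf T))
      (isPartition_of_mem_below hu) ?_⟩
    ext ⟨i, j⟩
    rw [YoungDiagram.mem_cells, YoungDiagram.mem_cells, hf' T, h]
  have := Fintype.ofFinite {T : SemistandardYoungTableau (rows t) // weight T = d}
  rw [Nat.card_eq_fintype_card, ← Finset.card_univ,
    Finset.card_eq_sum_card_fiberwise (f := f) (t := below t) fun T _ => hf T]
  refine Finset.sum_congr rfl fun u hu => ?_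
  have hup := isPartition_of_mem_below hu
  have hsub : rows u ≤ rows t := by
    rintro ⟨i, j⟩ h
    change (i, j) ∈ rows u at h
    rw [mem_rows hup] at h
    rw [mem_rows ht]
    rw [mem_below] at hu
    omega
  have hstrip : ∀ i j, (i + 1, j) ∈ rows t → (i, j) ∈ rows u := by
    intro i j h
    rw [mem_rows ht] at h
    rw [mem_rows hup]
    rw [mem_below] at hu
    omega
  have hcard : (Finset.univ.filter fun T => f T = u).card =
      Nat.card {T : SemistandardYoungTableau (rows t) // weight T = d ∧
        ∀ i j, (i, j) ∈ rows u ↔ (i, j) ∈ rows t ∧ T i j < N} := by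
    rw [← Fintype.card_subtype, ← Nat.card_eq_fintype_card]
    refine Nat.card_congr (((Equiv.subtypeEquivRight fun T => hfeq T u hu)).trans
      (Equiv.subtypeSubtypeEquivSubtypeInter (fun T => weight T = d) fun T =>
        ∀ i j, (i, j) ∈ rows u ↔ (i, j) ∈ rows t ∧ T i j < N))
  rw [hcard]
  split_ifs with h
  · exact card_fiber hsub hstrip hd (by rw [card_rows ht, card_rows hup, h])
  · rw [Nat.card_eq_zero]
    refine Or.inl ⟨fun ⟨T, hT, hTu⟩ => h ?_⟩
    have hw := weight_extend (N := N) hsub T (restrict hsub T)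
      (fun i j h => (restrict_of_mem hsub T h).symm) (fun i j h h' =>
        le_antisymm (hle T hT i j h) (not_lt.1 fun hl => h' ((hTu i j).2 ⟨h, hl⟩)))
    have h0 : weight (restrict hsub T) N = 0 := weight_eq_zero _ fun i j h => by
      rw [restrict_of_mem hsub T h]
      exact ((hTu i j).1 h).2.ne
    have := DFunLike.congr_fun hw N
    rw [Finsupp.add_apply, h0, Finsupp.single_eq_same, zero_add, hT, card_rows ht,
      card_rows hup] at this
    exact this.symm

/-! ### Schur polynomials and Pieri's rule. -/

/-- The Schur polynomial in `x₀, …, x_{N-1}` of a partition with at most three parts, as a sum over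
Gelfand–Tsetlin patterns. -/
noncomputable def schurPoly : ℕ → ℕ × ℕ × ℕ → MvPowerSeries ℕ ℤ
  | 0, t => if t = 0 then 1 else 0
  | N + 1, t => ∑ u ∈ below t, X N ^ (size t - size u) * schurPoly N u

theorem coeff_X_pow_mul_of_coeff_eq_zero {N k : ℕ} {g : MvPowerSeries ℕ ℤ}
    (hg : ∀ d : ℕ →₀ ℕ, d N ≠ 0 → coeff d g = 0) (d : ℕ →₀ ℕ) :
    coeff d (X N ^ k * g) = if k = d N then coeff (d.erase N) g else 0 := by
  rw [X_pow_eq, coeff_monomial_mul, one_mul]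
  split_ifs with h1 h2 h2
  · refine congrArg (fun e => coeff e g) (Finsupp.ext fun i => ?_)
    by_cases hi : i = N
    · simp [hi, h2]
    · simp [hi]
  · refine hg _ ?_
    have := h1 N
    simp only [Finsupp.single_eq_same] at this
    simp only [Finsupp.coe_tsub, Pi.sub_apply, Finsupp.single_eq_same]
    omega
  · refine absurd (fun i => ?_) h1
    by_cases hi : i = N
    · simp [hi, h2]
    · simp [hi]
  · rfl

theorem coeff_schurPoly_eq_zero (N : ℕ) (t : ℕ × ℕ × ℕ) (d : ℕ →₀ ℕ) {i : ℕ} (hi : N ≤ i)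
    (hd : d i ≠ 0) : coeff d (schurPoly N t) = 0 := by
  induction N generalizing t d i with
  | zero =>
    have : d ≠ 0 := fun h => hd (by simp [h])
    classical
    simp only [schurPoly]
    split_ifs <;> simp [coeff_one, this]
  | succ N ih =>
    rw [schurPoly, map_sum]
    refine Finset.sum_eq_zero fun u _ => ?_
    rw [coeff_X_pow_mul_of_coeff_eq_zero fun d hd => ih u d le_rfl hd]
    split_ifs
    · exact ih u (i := i) _ (by omega)
        (by simpa [Finsupp.erase_apply, show i ≠ N by omega] using hd)
    · rfl

theorem coeff_schurPoly_succ (N : ℕ) (t : ℕ × ℕ × ℕ) (d : ℕ →₀ ℕ) :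
    coeff d (schurPoly (N + 1) t) = ∑ u ∈ below t,
      if size t - size u = d N then coeff (d.erase N) (schurPoly N u) else 0 := by
  rw [schurPoly, map_sum]
  exact Finset.sum_congr rfl fun u _ =>
    coeff_X_pow_mul_of_coeff_eq_zero (fun d hd => coeff_schurPoly_eq_zero N u d le_rfl hd) d

/-- The coefficients of a Schur function agree with those of the Schur polynomials. -/
theorem coeff_schur_rows (N : ℕ) {t : ℕ × ℕ × ℕ} (ht : IsPartition t) {d : ℕ →₀ ℕ}
    (hd : ∀ i, N ≤ i → d i = 0) : coeff d (schur (rows t)) = coeff d (schurPoly N t) := by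
  change ((Nat.card {T : SemistandardYoungTableau (rows t) // weight T = d} : ℕ) : ℤ) = _
  induction N generalizing t d with
  | zero =>
    obtain rfl : d = 0 := Finsupp.ext fun i => hd i (Nat.zero_le i)
    rw [schurPoly]
    split_ifs with h
    · subst h
      have hμ : ∀ i j, (i, j) ∉ rows 0 := fun i j => by rw [mem_rows ht]; simp
      rw [coeff_zero_one, Nat.cast_eq_one, Nat.card_eq_one_iff_unique]
      refine ⟨⟨fun T T' => Subtype.ext ?_⟩, ⟨default, ?_⟩⟩
      · ext i j
        rw [T.1.zeros (hμ i j), T'.1.zeros (hμ i j)]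
      · ext k
        exact weight_eq_zero _ fun i j h => absurd h (hμ i j)
    · rw [map_zero, Nat.cast_eq_zero, Nat.card_eq_zero]
      refine Or.inl ⟨fun T => h ?_⟩
      have := degree_weight T.1
      rw [T.2, card_rows ht, map_zero] at this
      simp only [size] at this
      ext <;> simp <;> omega
  | succ N ih =>
    rw [card_weight_rows ht fun i hi => hd i hi, coeff_schurPoly_succ, Nat.cast_sum]
    refine Finset.sum_congr rfl fun u hu => ?_
    split_ifs
    · refine ih (isPartition_of_mem_below hu) fun i hi => ?_
      rw [Finsupp.erase_apply]
      split_ifs with h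
      · rfl
      · exact hd i (by omega)
    · rfl

/-- The partitions obtained from `(p, q)` by adding a horizontal strip of size `c`. -/
def pieriSet (c p q : ℕ) : Finset (ℕ × ℕ × ℕ) :=
  (Finset.Icc p (p + c) ×ˢ Finset.Icc q p ×ˢ Finset.Icc 0 q).filter fun t => size t = p + q + c

theorem mem_pieriSet {c p q : ℕ} {t : ℕ × ℕ × ℕ} : t ∈ pieriSet c p q ↔
    p ≤ t.1 ∧ (q ≤ t.2.1 ∧ t.2.1 ≤ p) ∧ t.2.2 ≤ q ∧ t.1 + t.2.1 + t.2.2 = p + q + c := by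
  rw [pieriSet, Finset.mem_filter, Finset.mem_product, Finset.mem_product]
  simp only [Finset.mem_Icc, size]
  omega

theorem isPartition_of_mem_pieriSet {c p q : ℕ} {t : ℕ × ℕ × ℕ} (h : t ∈ pieriSet c p q) :
    IsPartition t := by
  rw [mem_pieriSet] at h
  simp only [IsPartition]
  omega

/-- Pieri's rule for Schur polynomials. -/
theorem schurPoly_pieri (N : ℕ) {c p q : ℕ} (hpq : q ≤ p) :
    schurPoly N (c, 0, 0) * schurPoly N (p, q, 0) = ∑ t ∈ pieriSet c p q, schurPoly N t := by
  induction N generalizing c p q with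
  | zero =>
    simp only [schurPoly]
    rw [Finset.sum_ite_eq' (pieriSet c p q) 0 fun _ => (1 : MvPowerSeries ℕ ℤ), ite_mul, zero_mul,
      one_mul, ← ite_and]
    refine if_congr ?_ rfl rfl
    rw [mem_pieriSet]
    simp only [Prod.mk_eq_zero, Prod.fst_zero, Prod.snd_zero, and_true]
    omega
  | succ N ih =>
    simp only [schurPoly]
    rw [Finset.sum_mul_sum]
    -- Split `X N` off both factors and apply the rule in one variable fewer. The resulting summand
    -- depends on `w` alone, and so does that of the other side (`h2`), so only the index sets
    -- remain to be matched.
    have h1 : ∀ u ∈ below (c, 0, 0), ∀ v ∈ below (p, q, 0),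
        X N ^ (size (c, 0, 0) - size u) * schurPoly N u *
          (X N ^ (size (p, q, 0) - size v) * schurPoly N v) =
        ∑ w ∈ pieriSet u.1 v.1 v.2.1, X N ^ (p + q + c - size w) * schurPoly N w := by
      rintro ⟨c', _, _⟩ hu ⟨p', q', _⟩ hv
      rw [mem_below] at hu hv
      simp only at hu hv
      obtain ⟨hu1, ⟨-, hu2⟩, hu3⟩ := hu
      obtain ⟨hv1, hv2, hv3⟩ := hv
      obtain rfl := Nat.le_zero.1 hu2
      obtain rfl := Nat.le_zero.1 hu3
      obtain rfl := Nat.le_zero.1 hv3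
      rw [mul_mul_mul_comm, ih (by omega : q' ≤ p'), ← pow_add, Finset.mul_sum]
      refine Finset.sum_congr rfl fun w hw => ?_
      rw [mem_pieriSet] at hw
      congr 2
      simp only [size] at *
      omega
    rw [Finset.sum_congr rfl fun u hu => Finset.sum_congr rfl (h1 u hu)]
    have h2 : ∀ t ∈ pieriSet c p q, ∀ w ∈ below t, X N ^ (size t - size w) * schurPoly N w =
        X N ^ (p + q + c - size w) * schurPoly N w := by
      intro t ht w _
      rw [mem_pieriSet] at ht
      congr 2
      simp only [size]
      omega
    rw [Finset.sum_congr rfl fun t ht => Finset.sum_congr rfl (h2 t ht)]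
    simp only [Finset.sum_sigma']
    -- For fixed `w = (a, b, e)`, the entry `p'` ranges over `[max q b, min p a]` and `q'` over `[e,
    -- min q b]`. The second and third parts of `t` range over the same two intervals, and
    -- reflecting each interval gives the bijection. The first part of `t` and the number `c'` are
    -- then forced by size.
    refine Finset.sum_bij'
      (fun x _ => ⟨(p + q + c - (max q x.2.2.2.1 + min p x.2.2.1 - x.2.1.1) -
          (x.2.2.2.2 + min q x.2.2.2.1 - x.2.1.2.1),
        max q x.2.2.2.1 + min p x.2.2.1 - x.2.1.1, x.2.2.2.2 + min q x.2.2.2.1 - x.2.1.2.1),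
        x.2.2⟩)
      (fun y _ => ⟨(size y.2 - (max q y.2.2.1 + min p y.2.1 - y.1.2.1) -
          (y.2.2.2 + min q y.2.2.1 - y.1.2.2), 0, 0),
        (max q y.2.2.1 + min p y.2.1 - y.1.2.1, y.2.2.2 + min q y.2.2.1 - y.1.2.2, 0), y.2⟩)
      ?_ ?_ ?_ ?_ ?_
    · rintro ⟨⟨c', z1, z2⟩, ⟨p', q', z3⟩, ⟨a, b, e⟩⟩ h
      simp only [Finset.mem_sigma, mem_below, mem_pieriSet] at h ⊢
      omega
    · rintro ⟨⟨m1, m2, m3⟩, ⟨a, b, e⟩⟩ h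
      simp only [Finset.mem_sigma, mem_below, mem_pieriSet, size] at h ⊢
      omega
    · rintro ⟨⟨c', z1, z2⟩, ⟨p', q', z3⟩, ⟨a, b, e⟩⟩ h
      simp only [Finset.mem_sigma, mem_below, mem_pieriSet] at h
      simp only [Sigma.mk.injEq, heq_eq_eq, Prod.mk.injEq, and_true, size]
      omega
    · rintro ⟨⟨m1, m2, m3⟩, ⟨a, b, e⟩⟩ h
      simp only [Finset.mem_sigma, mem_below, mem_pieriSet] at h
      simp only [Sigma.mk.injEq, heq_eq_eq, Prod.mk.injEq, and_true]
      omega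
    · intros; rfl

theorem schurRow_eq (n : ℕ) : schurRow n = schur (rows (n, 0, 0)) := by
  rw [schurRow]
  congr 1
  ext ⟨i, j⟩
  rw [YoungDiagram.mem_cells, YoungDiagram.mem_cells, mem_rows ⟨Nat.zero_le _, le_rfl⟩]
  refine YoungDiagram.mem_ofRowLens.trans ?_
  rcases i with _ | i <;> simp

theorem exists_forall_eq_zero (d : ℕ →₀ ℕ) : ∃ N, ∀ i, N ≤ i → d i = 0 := by
  obtain ⟨M, hM⟩ := d.support.bddAbove
  refine ⟨M + 1, fun i hi => ?_⟩
  by_contra h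
  have := hM (Finsupp.mem_support_iff.2 h)
  omega

/-- Pieri's rule for partitions with at most two parts. -/
theorem schur_pieri {c p q : ℕ} (hpq : q ≤ p) :
    schurRow c * schur (rows (p, q, 0)) = ∑ t ∈ pieriSet c p q, schur (rows t) := by
  classical
  ext d
  obtain ⟨N, hN⟩ := exists_forall_eq_zero d
  rw [schurRow_eq, map_sum, Finset.sum_congr rfl fun t ht =>
    coeff_schur_rows N (isPartition_of_mem_pieriSet ht) hN, ← map_sum, ← schurPoly_pieri N hpq,
    coeff_mul, coeff_mul]
  refine Finset.sum_congr rfl fun e he => ?_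
  rw [Finset.HasAntidiagonal.mem_antidiagonal] at he
  have h : ∀ i, N ≤ i → e.1 i = 0 ∧ e.2 i = 0 := fun i hi => by
    have := hN i hi
    rw [← he, Finsupp.add_apply] at this
    omega
  rw [coeff_schur_rows N ⟨Nat.zero_le _, le_rfl⟩ fun i hi => (h i hi).1,
    coeff_schur_rows N ⟨hpq, Nat.zero_le _⟩ fun i hi => (h i hi).2]

/-! ### Complete homogeneous functions and the grading. -/

theorem degree_eq_degree_erase_add (d : ℕ →₀ ℕ) (i : ℕ) : d.degree = (d.erase i).degree + d i := by
  conv_lhs => rw [← Finsupp.single_add_erase i d]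
  rw [map_add, Finsupp.degree_single, add_comm]

/-- The coefficient depends only on the degree of the monomial, which gives both symmetry and
homogeneity in `schurRow_mem_Lam`. -/
theorem coeff_schurRow (m : ℕ) (d : ℕ →₀ ℕ) :
    coeff d (schurRow m) = if d.degree = m then 1 else 0 := by
  obtain ⟨N, hN⟩ := exists_forall_eq_zero d
  rw [schurRow_eq, coeff_schur_rows N ⟨Nat.zero_le _, le_rfl⟩ hN]
  induction N generalizing m d with
  | zero =>
    obtain rfl : d = 0 := Finsupp.ext fun i => hN i (Nat.zero_le i)
    classical
    simp only [schurPoly, Prod.mk_eq_zero, map_zero, and_true, eq_comm (a := (0 : ℕ))]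
    split_ifs <;> simp
  | succ N ih =>
    have hd := degree_eq_degree_erase_add d N
    have hN' : ∀ i, N ≤ i → d.erase N i = 0 := fun i hi => by
      rw [Finsupp.erase_apply]
      split_ifs with h
      · rfl
      · exact hN i (by omega)
    rw [coeff_schurPoly_succ]
    -- Only one row length survives: the degree left after erasing the last variable.
    have key : ∀ u ∈ below (m, 0, 0), (if size (m, 0, 0) - size u = d N then
        coeff (d.erase N) (schurPoly N u) else 0) =
        if u = ((d.erase N).degree, 0, 0) then (if d.degree = m then 1 else 0) else 0 := by
      rintro ⟨a, b, e⟩ hu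
      rw [mem_below] at hu
      obtain ⟨rfl, rfl⟩ : b = 0 ∧ e = 0 := by simp only at hu; omega
      rw [ih a _ hN']
      rw [← ite_and, ← ite_and]
      refine if_congr ?_ rfl rfl
      simp only [size, Prod.mk.injEq, and_true] at hu ⊢
      omega
    rw [Finset.sum_congr rfl key, Finset.sum_ite_eq', ← ite_and]
    refine if_congr ?_ rfl rfl
    rw [mem_below]
    simp only
    omega

theorem schurRow_zero : schurRow 0 = 1 := by
  classical
  ext d
  rw [coeff_schurRow, coeff_one]
  simp [Finsupp.degree_eq_zero_iff]

theorem schurRow_mem_Lam (n : ℕ) : schurRow n ∈ Lam n := by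
  refine ⟨fun d hd => ?_, fun σ d => ?_⟩
  · by_contra h
    exact hd (by rw [coeff_schurRow, if_neg h])
  · rw [coeff_schurRow, coeff_schurRow, Finsupp.equivMapDomain_eq_mapDomain,
      Finsupp.degree_mapDomain]

theorem mul_mem_Lam {m n : ℕ} {f g : MvPowerSeries ℕ ℤ} (hf : f ∈ Lam m) (hg : g ∈ Lam n) :
    f * g ∈ Lam (m + n) := by
  classical
  refine ⟨fun d hd => ?_, fun σ d => ?_⟩
  · rw [coeff_mul] at hd
    obtain ⟨e, he, hne⟩ := Finset.exists_ne_zero_of_sum_ne_zero hd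
    rw [Finset.HasAntidiagonal.mem_antidiagonal] at he
    rw [← he, map_add, hf.1 _ (left_ne_zero_of_mul hne), hg.1 _ (right_ne_zero_of_mul hne)]
  · rw [coeff_mul, coeff_mul]
    symm
    refine Finset.sum_nbij' (fun e => (e.1.equivMapDomain σ, e.2.equivMapDomain σ))
      (fun e => (e.1.equivMapDomain σ.symm, e.2.equivMapDomain σ.symm)) ?_ ?_ ?_ ?_ ?_
    · intro e he
      rw [Finset.HasAntidiagonal.mem_antidiagonal] at he ⊢
      subst he
      ext i; simp
    · intro e he
      rw [Finset.HasAntidiagonal.mem_antidiagonal] at he ⊢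
      have : d = (d.equivMapDomain σ).equivMapDomain σ.symm := by ext i; simp
      rw [this, ← he]
      ext i; simp
    · intro e _
      ext i <;> simp
    · intro e _
      ext i <;> simp
    · intro e _
      rw [hf.2, hg.2]

/-! ### Schur expansions as coefficient functions on integer triples. -/

/-- The triple of integers consists of the parts of a partition. -/
def IsIntPartition (t : ℤ × ℤ × ℤ) : Prop := t.2.1 ≤ t.1 ∧ t.2.2 ≤ t.2.1 ∧ 0 ≤ t.2.2

/-- The triple of natural numbers underlying a triple of integers. -/
def natTriple (t : ℤ × ℤ × ℤ) : ℕ × ℕ × ℕ := (t.1.toNat, t.2.1.toNat, t.2.2.toNat)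

/-- The triple of integers underlying a triple of natural numbers. -/
def intTriple (t : ℕ × ℕ × ℕ) : ℤ × ℤ × ℤ := (t.1, t.2.1, t.2.2)

theorem natTriple_intTriple (t : ℕ × ℕ × ℕ) : natTriple (intTriple t) = t := by
  simp [natTriple, intTriple]

theorem isIntPartition_intTriple {t : ℕ × ℕ × ℕ} (ht : IsPartition t) :
    IsIntPartition (intTriple t) := by
  simp only [IsPartition, IsIntPartition, intTriple] at *
  omega

theorem isPartition_natTriple {t : ℤ × ℤ × ℤ} (ht : IsIntPartition t) :
    IsPartition (natTriple t) := by
  simp only [IsPartition, IsIntPartition, natTriple] at *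
  omega

/-- The diagram of a triple of integers. -/
def diagram (t : ℤ × ℤ × ℤ) : YoungDiagram := rows (natTriple t)

theorem diagram_injOn : Set.InjOn diagram {t | IsIntPartition t} := by
  rintro ⟨a, b, c⟩ ht ⟨a', b', c'⟩ ht' h
  have := rows_injOn (isPartition_natTriple ht) (isPartition_natTriple ht') h
  simp only [IsIntPartition, natTriple, Set.mem_ofPred_eq, Prod.mk.injEq] at *
  omega

theorem addParts_diagram {t u : ℤ × ℤ × ℤ} (ht : IsIntPartition t) (hu : IsIntPartition u) :
    addParts (diagram t) (diagram u) = diagram (t + u) := by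
  have htu : IsIntPartition (t + u) := by
    simp only [IsIntPartition, Prod.fst_add, Prod.snd_add] at *
    omega
  refine eq_of_rowLen_eq fun i => ?_
  rw [rowLen_addParts]
  simp only [diagram, rowLen_rows (isPartition_natTriple ht),
    rowLen_rows (isPartition_natTriple hu), rowLen_rows (isPartition_natTriple htu)]
  simp only [IsIntPartition, natTriple, Prod.fst_add, Prod.snd_add] at *
  split_ifs <;> omega

/-- `f = ∑ k(t) s_t`, where `t` runs over finitely many partitions with at most three parts. -/
def HasSchurCoeffs (f : MvPowerSeries ℕ ℤ) (k : ℤ × ℤ × ℤ → ℤ) : Prop :=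
  ∃ c : (ℤ × ℤ × ℤ) →₀ ℤ, (∀ t, c t = k t) ∧ (∀ t, c t ≠ 0 → IsIntPartition t) ∧
    f = Finsupp.linearCombination ℤ (fun t => schur (diagram t)) c

theorem linearCombination_schur_diagram (c : (ℤ × ℤ × ℤ) →₀ ℤ) :
    Finsupp.linearCombination ℤ (fun t => schur (diagram t)) c =
      Finsupp.linearCombination ℤ schur (c.mapDomain diagram) := by
  rw [Finsupp.linearCombination_mapDomain]
  rfl

namespace HasSchurCoeffs

variable {f g : MvPowerSeries ℕ ℤ} {k l : ℤ × ℤ × ℤ → ℤ}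

theorem zero : HasSchurCoeffs 0 fun _ => 0 :=
  ⟨0, fun _ => rfl, fun _ h => absurd rfl h, by simp⟩

theorem add (hf : HasSchurCoeffs f k) (hg : HasSchurCoeffs g l) :
    HasSchurCoeffs (f + g) fun t => k t + l t := by
  obtain ⟨c, hc, hc', rfl⟩ := hf
  obtain ⟨e, he, he', rfl⟩ := hg
  refine ⟨c + e, fun t => by rw [Finsupp.add_apply, hc, he], fun t h => ?_, by rw [map_add]⟩
  by_contra hn
  refine h ?_
  rw [Finsupp.add_apply, not_not.1 fun h' => hn (hc' t h'), not_not.1 fun h' => hn (he' t h'),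
    add_zero]

theorem sub (hf : HasSchurCoeffs f k) (hg : HasSchurCoeffs g l) :
    HasSchurCoeffs (f - g) fun t => k t - l t := by
  obtain ⟨c, hc, hc', rfl⟩ := hf
  obtain ⟨e, he, he', rfl⟩ := hg
  refine ⟨c - e, fun t => by rw [Finsupp.sub_apply, hc, he], fun t h => ?_, by rw [map_sub]⟩
  by_contra hn
  refine h ?_
  rw [Finsupp.sub_apply, not_not.1 fun h' => hn (hc' t h'), not_not.1 fun h' => hn (he' t h'),
    sub_zero]

theorem sum {ι : Type*} {s : Finset ι} {f : ι → MvPowerSeries ℕ ℤ} {k : ι → ℤ × ℤ × ℤ → ℤ}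
    (h : ∀ i ∈ s, HasSchurCoeffs (f i) (k i)) :
    HasSchurCoeffs (∑ i ∈ s, f i) fun t => ∑ i ∈ s, k i t := by
  classical
  induction s using Finset.induction_on with
  | empty => simpa using zero
  | insert i s hi ih =>
    simp only [Finset.sum_insert hi]
    exact (h i (Finset.mem_insert_self i s)).add
      (ih fun j hj => h j (Finset.mem_insert_of_mem hj))

theorem schur_rows {t : ℕ × ℕ × ℕ} (ht : IsPartition t) :
    HasSchurCoeffs (schur (rows t)) fun u => if u = intTriple t then 1 else 0 := by
  classical
  refine ⟨Finsupp.single (intTriple t) 1, fun u => ?_, fun u hu => ?_, ?_⟩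
  · rw [Finsupp.single_apply]
    exact if_congr eq_comm rfl rfl
  · obtain rfl : intTriple t = u := by
      by_contra h
      exact hu (Finsupp.single_eq_of_ne (Ne.symm h))
    exact isIntPartition_intTriple ht
  · rw [Finsupp.linearCombination_single, one_smul, diagram, natTriple_intTriple]

/-- Integer indices make the shift a pure translation: when `t - u` is not a partition, `k` vanishes
there and no boundary case arises. -/
theorem shift {u : ℤ × ℤ × ℤ} (hf : HasSchurCoeffs f k) (hu : IsIntPartition u) :
    HasSchurCoeffs (shift (diagram u) f) fun t => k (t - u) := by
  obtain ⟨c, hc, hc', rfl⟩ := hf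
  refine ⟨c.equivMapDomain (Equiv.addRight u), fun t => ?_, fun t ht => ?_, ?_⟩
  · simp only
    rw [Finsupp.equivMapDomain_apply, ← hc]
    simp [sub_eq_add_neg]
  · rw [Finsupp.equivMapDomain_apply] at ht
    have := hc' _ ht
    simp only [Equiv.addRight_symm, Equiv.coe_addRight, IsIntPartition, Prod.fst_add,
      Prod.snd_add, Prod.fst_neg, Prod.snd_neg] at this hu ⊢
    omega
  · rw [linearCombination_schur_diagram, shift_linearCombination,
      Finsupp.linearCombination_mapDomain, Finsupp.equivMapDomain_eq_mapDomain, Finsupp.linearCombination_mapDomain,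
      Finsupp.linearCombination_apply, Finsupp.linearCombination_apply]
    refine Finsupp.sum_congr fun t ht => ?_
    simp only [Function.comp_apply, Equiv.coe_addRight]
    rw [addParts_diagram (hc' t (Finsupp.mem_support_iff.1 ht)) hu]

/-- `diagram` is injective on partitions only; the support condition in `HasSchurCoeffs` is what
lets linear independence of the Schur functions apply. -/
theorem eq_zero_iff (hf : HasSchurCoeffs f k) : f = 0 ↔ ∀ t, k t = 0 := by
  obtain ⟨c, hc, hc', rfl⟩ := hf
  constructor
  · intro h t
    rw [linearCombination_schur_diagram] at h
    have h2 := linearIndependent_iff.1 schur_linearIndependent _ h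
    have h3 : c = 0 := Finsupp.mapDomain_injOn _ diagram_injOn
      (fun t ht => hc' t (Finsupp.mem_support_iff.1 ht)) (by simp) (h2.trans (by simp))
    rw [← hc, h3, Finsupp.zero_apply]
  · intro h
    obtain rfl : c = 0 := Finsupp.ext fun t => (hc t).trans (h t)
    rw [map_zero]

end HasSchurCoeffs

/-! ### Kostka numbers for three parts. -/

/-- The number of semistandard tableaux of shape `t` and weight `(a, b, c)`, for `b ≤ a`. -/
def kostka (a b c : ℤ) (t : ℤ × ℤ × ℤ) : ℤ :=
  if t.2.1 ≤ t.1 ∧ t.2.2 ≤ t.2.1 ∧ 0 ≤ t.2.2 ∧ t.1 + t.2.1 + t.2.2 = a + b + c then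
    max 0 (1 + min t.2.1 (min b (a + b - t.2.1)) - max t.2.2 (t.2.1 + t.2.2 - c))
  else 0

theorem schurRow_mul_schurRow_mul_schurRow (a b c : ℕ) :
    schurRow a * schurRow b * schurRow c =
      ∑ t ∈ pieriSet b a 0, ∑ u ∈ pieriSet c t.1 t.2.1, schur (rows u) := by
  rw [mul_comm (schurRow a), schurRow_eq a, schur_pieri (Nat.zero_le a), mul_comm, Finset.mul_sum]
  refine Finset.sum_congr rfl fun t ht => ?_
  have h := isPartition_of_mem_pieriSet ht
  rw [mem_pieriSet] at ht
  obtain ⟨p, q, r⟩ := t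
  obtain rfl : r = 0 := by simp only at ht; omega
  exact schur_pieri h.1

/-- The expansion of a product of three complete homogeneous symmetric functions. -/
theorem hasSchurCoeffs_kostka {a b : ℕ} (c : ℕ) (hab : b ≤ a) :
    HasSchurCoeffs (schurRow a * schurRow b * schurRow c) (kostka a b c) := by
  classical
  rw [schurRow_mul_schurRow_mul_schurRow]
  convert HasSchurCoeffs.sum fun t _ => HasSchurCoeffs.sum fun u hu =>
    HasSchurCoeffs.schur_rows (isPartition_of_mem_pieriSet hu) using 1
  ext ⟨x, y, z⟩
  by_cases h : y ≤ x ∧ z ≤ y ∧ 0 ≤ z ∧ x + y + z = a + b + c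
  · obtain ⟨x, rfl⟩ := Int.eq_ofNat_of_zero_le (show 0 ≤ x by omega)
    obtain ⟨y, rfl⟩ := Int.eq_ofNat_of_zero_le (show 0 ≤ y by omega)
    obtain ⟨z, rfl⟩ := Int.eq_ofNat_of_zero_le (show 0 ≤ z by omega)
    have key : ∀ t ∈ pieriSet b a 0, (∑ u ∈ pieriSet c t.1 t.2.1,
        if ((x : ℤ), (y : ℤ), (z : ℤ)) = intTriple u then (1 : ℤ) else 0) =
        if (x, y, z) ∈ pieriSet c t.1 t.2.1 then 1 else 0 := by
      intro t _
      rw [← Finset.sum_ite_eq (pieriSet c t.1 t.2.1) (x, y, z) fun _ => (1 : ℤ)]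
      refine Finset.sum_congr rfl fun u _ => if_congr ?_ rfl rfl
      simp [intTriple, Prod.ext_iff]
    rw [Finset.sum_congr rfl key, ← Finset.sum_filter, Finset.sum_const, nsmul_one]
    -- The intermediate shape is `(a + b - q, q)`. Interlacing with `(x, y, z)` bounds `q` below by
    -- `z` and `y + z - c` (the latter from `a + b - q ≤ x`) and above by `y` and `a + b - y`; the
    -- first Pieri step gives `q ≤ b`.
    have hcard : ((pieriSet b a 0).filter fun t => (x, y, z) ∈ pieriSet c t.1 t.2.1).card =
        (Finset.Icc (max z (y + z - c) : ℤ) (min y (min b (a + b - y)))).card := by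
      refine Finset.card_nbij' (fun t => (t.2.1 : ℤ)) (fun q => (a + b - q.toNat, q.toNat, 0))
        ?_ ?_ ?_ ?_
      · rintro ⟨p, q, r⟩ ht
        simp only [Finset.coe_filter, Set.mem_ofPred_eq, mem_pieriSet, Finset.coe_Icc,
          Set.mem_Icc] at ht ⊢
        omega
      · intro q hq
        simp only [Finset.coe_filter, Set.mem_ofPred_eq, mem_pieriSet, Finset.coe_Icc,
          Set.mem_Icc] at hq ⊢
        omega
      · rintro ⟨p, q, r⟩ ht
        simp only [Finset.coe_filter, Set.mem_ofPred_eq, mem_pieriSet] at ht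
        simp only [Prod.mk.injEq, Int.toNat_natCast, true_and]
        omega
      · intro q hq
        simp only [Finset.coe_Icc, Set.mem_Icc] at hq
        simp only
        omega
    rw [hcard, Int.card_Icc, kostka, if_pos h]
    simp only
    omega
  · rw [kostka, if_neg h]
    symm
    refine Finset.sum_eq_zero fun t ht => Finset.sum_eq_zero fun u hu => if_neg fun he => h ?_
    rw [mem_pieriSet] at ht hu
    simp only [intTriple, Prod.mk.injEq] at he
    omega

/-! ### Difference operators on coefficient functions. -/

/-- The coefficients of `Δ_m^u f`, given those of `f`. -/
def diffCoeffs (m : ℤ) (u : ℤ × ℤ × ℤ) (k : ℤ → ℤ × ℤ × ℤ → ℤ) (n : ℤ) (t : ℤ × ℤ × ℤ) : ℤ :=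
  k n t - k (n - m) (t - u)

/-- The terms of the sequence `f` have Schur coefficients `k`, which vanish at negative indices. -/
def SeqHasSchurCoeffs (f : ℕ → MvPowerSeries ℕ ℤ) (k : ℤ → ℤ × ℤ × ℤ → ℤ) : Prop :=
  (∀ n : ℕ, HasSchurCoeffs (f n) (k n)) ∧ ∀ n < 0, ∀ t, k n t = 0

namespace SeqHasSchurCoeffs

variable {f : ℕ → MvPowerSeries ℕ ℤ} {k : ℤ → ℤ × ℤ × ℤ → ℤ}

/-- Vanishing at negative indices matches the convention of `Diff` for `n < m`, so one formula
covers all `n`. -/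
theorem diff (h : SeqHasSchurCoeffs f k) (m : ℕ) {u : ℤ × ℤ × ℤ} (hu : IsIntPartition u) :
    SeqHasSchurCoeffs (Diff m (diagram u) f) (diffCoeffs m u k) := by
  refine ⟨fun n => ?_, fun n hn t => ?_⟩
  · rw [Diff]
    split_ifs with hmn
    · have := (h.1 n).sub ((h.1 (n - m)).shift hu)
      rwa [Nat.cast_sub hmn] at this
    · convert h.1 n using 1
      ext t
      rw [diffCoeffs, h.2 (n - m) (by omega), sub_zero]
  · rw [diffCoeffs, h.2 n hn, h.2 (n - m) (by omega), sub_zero]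

theorem not_eventuallyZero (h : SeqHasSchurCoeffs f k) (t : ℤ → ℤ × ℤ × ℤ) (n₀ : ℕ)
    (hk : ∀ n : ℤ, n₀ ≤ n → k n (t n) ≠ 0) : ¬ EventuallyZero f := by
  rintro ⟨N, hN⟩
  have := hN (N + 1 + n₀) (by omega)
  exact hk ((N + 1 + n₀ : ℕ) : ℤ) (by omega) (((h.1 _).eq_zero_iff.1 this) _)

end SeqHasSchurCoeffs

theorem part_eq_diagram_two : part [2] = diagram (2, 0, 0) := YoungDiagram.ext (by decide)

theorem part_eq_diagram_one_one : part [1, 1] = diagram (1, 1, 0) := YoungDiagram.ext (by decide)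

theorem part_eq_diagram_three : part [3] = diagram (3, 0, 0) := YoungDiagram.ext (by decide)

theorem part_eq_diagram_two_one : part [2, 1] = diagram (2, 1, 0) := YoungDiagram.ext (by decide)

theorem part_eq_diagram_one_one_one : part [1, 1, 1] = diagram (1, 1, 1) :=
  YoungDiagram.ext (by decide)

theorem part_eq_diagram_three_three : part [3, 3] = diagram (3, 3, 0) :=
  YoungDiagram.ext (by decide)

/-! ### Successive differences of the two product sequences. -/

/-- The Schur coefficients of `s_{(n+α)} s_{(n)}`. -/
def pairCoeffs (α n : ℤ) (t : ℤ × ℤ × ℤ) : ℤ := if 0 ≤ n then kostka (n + α) n 0 t else 0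

/-- The Schur coefficients of `s_{(n+α)} s_{(n+β)} s_{(n)}`. -/
def tripleCoeffs (α β n : ℤ) (t : ℤ × ℤ × ℤ) : ℤ :=
  if 0 ≤ n then kostka (n + α) (n + β) n t else 0

theorem seqHasSchurCoeffs_pair (α : ℕ) :
    SeqHasSchurCoeffs (fun n => schurRow (n + α) * schurRow n) (pairCoeffs α) := by
  refine ⟨fun n => ?_, fun n hn t => if_neg (by omega)⟩
  have h := hasSchurCoeffs_kostka 0 (show n ≤ n + α by omega)
  rw [schurRow_zero, mul_one] at h
  convert h using 1
  ext t
  simp [pairCoeffs]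

theorem seqHasSchurCoeffs_triple {α β : ℕ} (h : β ≤ α) :
    SeqHasSchurCoeffs (fun n => schurRow (n + α) * schurRow (n + β) * schurRow n)
      (tripleCoeffs α β) := by
  refine ⟨fun n => ?_, fun n hn t => if_neg (by omega)⟩
  convert hasSchurCoeffs_kostka n (show n + β ≤ n + α by omega) using 1
  ext t
  simp [tripleCoeffs]

/-- The product is the sum of the `s_{(2n+α-j, j)}` for `0 ≤ j ≤ n`; adding (1,1) to the previous
term produces all of these except `j = 0`. -/
theorem diffCoeffs_pair {α : ℤ} (hα : 0 ≤ α) {n : ℤ} (hn : 0 ≤ n) (x y z : ℤ) :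
    diffCoeffs 1 (1, 1, 0) (pairCoeffs α) n (x, y, z) =
      if x = 2 * n + α ∧ y = 0 ∧ z = 0 then 1 else 0 := by
  simp only [diffCoeffs, pairCoeffs, kostka, Prod.mk_sub_mk]
  split_ifs <;> omega

theorem diffCoeffs_diffCoeffs_pair {α : ℤ} (hα : 0 ≤ α) {n : ℤ} (hn : 1 ≤ n) (t : ℤ × ℤ × ℤ) :
    diffCoeffs 1 (2, 0, 0) (diffCoeffs 1 (1, 1, 0) (pairCoeffs α)) n t = 0 := by
  obtain ⟨x, y, z⟩ := t
  rw [diffCoeffs, Prod.mk_sub_mk, Prod.mk_sub_mk, diffCoeffs_pair hα (by omega),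
    diffCoeffs_pair hα (by omega)]
  split_ifs <;> omega

/-- With three letters the third row can only contain the last one, which occurs `m` times. -/
theorem tripleCoeffs_eq_zero {α β m x y z : ℤ} (h : m < z) : tripleCoeffs α β m (x, y, z) = 0 := by
  simp only [tripleCoeffs, kostka]
  split_ifs <;> omega

section triple

variable {α β : ℤ} (hβ : 0 ≤ β) (hαβ : β ≤ α)

include hβ hαβ

/-- In three letters a column of height three is forced, so deleting it is a bijection and the
shapes with `z ≥ 1` cancel. -/
theorem diffCoeffs_one_one_one_triple (n x y z : ℤ) :
    diffCoeffs 1 (1, 1, 1) (tripleCoeffs α β) n (x, y, z) =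
      if 0 ≤ n ∧ 0 ≤ y ∧ y ≤ x ∧ z = 0 ∧ x + y = 3 * n + α + β then
        max 0 (1 + min y (min (n + β) (2 * n + α + β - y)) - max 0 (y - n)) else 0 := by
  simp only [diffCoeffs, tripleCoeffs, kostka, Prod.mk_sub_mk]
  split_ifs <;> omega

/-- Passing from `(n, y)` to `(n - 1, y - 1)` keeps the lower end `max 0 (y - n)` of the counting
interval, for `y ≥ 1`, and lowers its upper end by one. The bound `α - β ≤ n` keeps the interval
nonempty for all `y ≤ x`. If `x = y` or `y = 0` there is no shifted term, but then the interval is a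
single point. -/
theorem diffCoeffs_two_one_triple {n : ℤ} (hn : 1 ≤ n) (hn' : α - β ≤ n) (x y z : ℤ) :
    diffCoeffs 1 (2, 1, 0) (diffCoeffs 1 (1, 1, 1) (tripleCoeffs α β)) n (x, y, z) =
      if 0 ≤ y ∧ y ≤ x ∧ z = 0 ∧ x + y = 3 * n + α + β then 1 else 0 := by
  rw [diffCoeffs, Prod.mk_sub_mk, Prod.mk_sub_mk, diffCoeffs_one_one_one_triple hβ hαβ,
    diffCoeffs_one_one_one_triple hβ hαβ]
  split_ifs <;> omega

/-- Adding (3) keeps `y` and yields exactly the shapes with `x ≥ y + 3`. Both bounds are those of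
the previous lemma at `n - 1`. -/
theorem diffCoeffs_three_triple {n : ℤ} (hn : 2 ≤ n) (hn' : α - β + 1 ≤ n) (x y z : ℤ) :
    diffCoeffs 1 (3, 0, 0) (diffCoeffs 1 (2, 1, 0)
        (diffCoeffs 1 (1, 1, 1) (tripleCoeffs α β))) n (x, y, z) =
      if 0 ≤ y ∧ y ≤ x ∧ x ≤ y + 2 ∧ z = 0 ∧ x + y = 3 * n + α + β then 1 else 0 := by
  rw [diffCoeffs, Prod.mk_sub_mk, Prod.mk_sub_mk,
    diffCoeffs_two_one_triple hβ hαβ (by omega) (by omega),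
    diffCoeffs_two_one_triple hβ hαβ (by omega) (by omega)]
  split_ifs <;> omega

/-- The parity of `x - y` is that of the size `3n + α + β`, so it repeats with period 2; hence the
step `m = 2`. -/
theorem diffCoeffs_three_three_triple {n : ℤ} (hn : 4 ≤ n) (hn' : α - β + 3 ≤ n)
    (t : ℤ × ℤ × ℤ) :
    diffCoeffs 2 (3, 3, 0) (diffCoeffs 1 (3, 0, 0) (diffCoeffs 1 (2, 1, 0)
        (diffCoeffs 1 (1, 1, 1) (tripleCoeffs α β)))) n t = 0 := by
  obtain ⟨x, y, z⟩ := t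
  rw [diffCoeffs, Prod.mk_sub_mk, Prod.mk_sub_mk,
    diffCoeffs_three_triple hβ hαβ (by omega) (by omega),
    diffCoeffs_three_triple hβ hαβ (by omega) (by omega)]
  split_ifs <;> omega

end triple

end SymmFun

/-! ### The proposition, with witnesses for minimality. -/

open SymmFun in
theorem mainTheorem3 (α₁ α₂ : ℕ) (hα : α₂ ≤ α₁) :
    -- part (a)
    (fun n => schurRow (n + α₁) * schurRow n) ∈ LamSeq α₁ 2 ∧
    (∀ n > 1, Diff 1 (part [2]) (Diff 1 (part [1, 1])
      (fun n => schurRow (n + α₁) * schurRow n)) n = 0) ∧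
    ¬ EventuallyZero (Diff 1 (part [1, 1]) (fun n => schurRow (n + α₁) * schurRow n)) ∧
    ¬ EventuallyZero (Diff 1 (part [2]) (fun n => schurRow (n + α₁) * schurRow n)) ∧
    -- part (b)
    (fun n => schurRow (n + α₁) * schurRow (n + α₂) * schurRow n) ∈ LamSeq (α₁ + α₂) 3 ∧
    (∀ n : ℕ, (n : ℤ) > max 4 ((α₁ : ℤ) - α₂ + 2) →
      Diff 2 (part [3, 3]) (Diff 1 (part [3]) (Diff 1 (part [2, 1]) (Diff 1 (part [1, 1, 1])
        (fun n => schurRow (n + α₁) * schurRow (n + α₂) * schurRow n)))) n = 0) ∧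
    ¬ EventuallyZero (Diff 1 (part [3]) (Diff 1 (part [2, 1]) (Diff 1 (part [1, 1, 1])
        (fun n => schurRow (n + α₁) * schurRow (n + α₂) * schurRow n)))) ∧
    ¬ EventuallyZero (Diff 2 (part [3, 3]) (Diff 1 (part [2, 1]) (Diff 1 (part [1, 1, 1])
        (fun n => schurRow (n + α₁) * schurRow (n + α₂) * schurRow n)))) ∧
    ¬ EventuallyZero (Diff 2 (part [3, 3]) (Diff 1 (part [3]) (Diff 1 (part [1, 1, 1])
        (fun n => schurRow (n + α₁) * schurRow (n + α₂) * schurRow n)))) ∧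
    ¬ EventuallyZero (Diff 2 (part [3, 3]) (Diff 1 (part [3]) (Diff 1 (part [2, 1])
        (fun n => schurRow (n + α₁) * schurRow (n + α₂) * schurRow n)))) := by
  have h2 : IsIntPartition (2, 0, 0) := by simp [IsIntPartition]
  have h11 : IsIntPartition (1, 1, 0) := by simp [IsIntPartition]
  have h3 : IsIntPartition (3, 0, 0) := by simp [IsIntPartition]
  have h21 : IsIntPartition (2, 1, 0) := by simp [IsIntPartition]
  have h111 : IsIntPartition (1, 1, 1) := by simp [IsIntPartition]
  have h33 : IsIntPartition (3, 3, 0) := by simp [IsIntPartition]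
  have hβ : (0 : ℤ) ≤ α₂ := by omega
  have hαβ : (α₂ : ℤ) ≤ α₁ := by omega
  have hp := seqHasSchurCoeffs_pair α₁
  have ht := seqHasSchurCoeffs_triple hα
  rw [part_eq_diagram_two, part_eq_diagram_one_one, part_eq_diagram_three,
    part_eq_diagram_two_one, part_eq_diagram_one_one_one, part_eq_diagram_three_three]
  refine ⟨fun n => ?_, fun n hn => ?_, ?_, ?_, fun n => ?_, fun n hn => ?_, ?_, ?_, ?_, ?_⟩
  · rw [show n * 2 + α₁ = n + α₁ + n by omega]
    exact mul_mem_Lam (schurRow_mem_Lam _) (schurRow_mem_Lam _)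
  · exact (((hp.diff 1 h11).diff 1 h2).1 n).eq_zero_iff.2
      (diffCoeffs_diffCoeffs_pair (by omega) (by omega))
  · refine (hp.diff 1 h11).not_eventuallyZero (fun n => (2 * n + α₁, 0, 0)) 0 fun n hn => ?_
    rw [Nat.cast_one, diffCoeffs_pair (by omega) (by omega)]
    simp
  -- The second row `n` is too long for a shape from index `n - 1` shifted by (2).
  · refine (hp.diff 1 h2).not_eventuallyZero (fun n => (n + α₁, n, 0)) 0 fun n hn => ?_
    simp only [diffCoeffs, pairCoeffs, kostka, Prod.mk_sub_mk, Nat.cast_one, sub_zero, add_zero,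
      and_true]
    split_ifs <;> omega
  · rw [show n * 3 + (α₁ + α₂) = n + α₁ + (n + α₂) + n by omega]
    exact mul_mem_Lam (mul_mem_Lam (schurRow_mem_Lam _) (schurRow_mem_Lam _)) (schurRow_mem_Lam _)
  · exact (((((ht.diff 1 h111).diff 1 h21).diff 1 h3).diff 2 h33).1 n).eq_zero_iff.2
      (diffCoeffs_three_three_triple hβ hαβ (by omega) (by omega))
  -- The most balanced two-row shape: its rows differ by at most 1.
  · refine (((ht.diff 1 h111).diff 1 h21).diff 1 h3).not_eventuallyZero
      (fun n => (3 * n + α₁ + α₂ - (3 * n + α₁ + α₂) / 2, (3 * n + α₁ + α₂) / 2, 0)) (α₁ + 2)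
      fun n hn => ?_
    rw [Nat.cast_one, diffCoeffs_three_triple hβ hαβ (by omega) (by omega), if_pos (by omega)]
    exact one_ne_zero
  -- A one-row shape cannot arise by adding (3,3).
  · refine (((ht.diff 1 h111).diff 1 h21).diff 2 h33).not_eventuallyZero
      (fun n => (3 * n + α₁ + α₂, 0, 0)) (α₁ + 3) fun n hn => ?_
    rw [diffCoeffs, Prod.mk_sub_mk, Prod.mk_sub_mk, Nat.cast_one, Nat.cast_ofNat,
      diffCoeffs_two_one_triple hβ hαβ (by omega) (by omega),
      diffCoeffs_two_one_triple hβ hαβ (by omega) (by omega)]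
    split_ifs <;> omega
  -- With second row `n` the counts at `n` and `n - 1` are `n + 1` and at most `n`. The two terms
  -- shifted by (3,3) have second row `n - 3` and both count `n - 2`, so they cancel and the
  -- coefficient is positive.
  · refine (((ht.diff 1 h111).diff 1 h3).diff 2 h33).not_eventuallyZero
      (fun n => (2 * n + α₁ + α₂, n, 0)) (α₁ + 5) fun n hn => ?_
    -- The pattern `(3, _)` unfolds the two outer differences only, keeping the innermost one for
    -- its closed formula.
    simp only [diffCoeffs.eq_1 _ (3, _), Prod.mk_sub_mk, Nat.cast_one, Nat.cast_ofNat,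
      diffCoeffs_one_one_one_triple hβ hαβ]
    split_ifs <;> omega
  -- None of the remaining shifts changes the third row, so a shape with third row `n` occurs at
  -- index `n` but in no earlier term; its coefficient is 1.
  · refine (((ht.diff 1 h21).diff 1 h3).diff 2 h33).not_eventuallyZero
      (fun n => (n + α₁, n + α₂, n)) (α₁ + 5) fun n hn => ?_
    simp only [diffCoeffs, Prod.mk_sub_mk, Nat.cast_one, Nat.cast_ofNat]
    have h0 : ∀ m < n, ∀ x y, tripleCoeffs α₁ α₂ m (x, y, n) = 0 := fun m hm x y =>
      tripleCoeffs_eq_zero hm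
    simp only [sub_zero]
    rw [h0 (n - 1) (by omega), h0 (n - 1) (by omega), h0 (n - 1 - 1) (by omega),
      h0 (n - 2) (by omega), h0 (n - 2 - 1) (by omega), h0 (n - 2 - 1) (by omega),
      h0 (n - 2 - 1 - 1) (by omega), tripleCoeffs, if_pos (by omega), kostka,
      if_pos (by simp only [and_true]; omega)]
    simp only
    omega
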